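/- Let $\mathcal A$ be a (complex, not necessarily unital) $C^*$-algebra; all ideals are closed and two-sided. For a $C^*$-algebra $\mathcal B$, let $\mathcal I^{At}(\mathcal B)$ be the $C^*$-subalgebra (in fact an ideal) of $\mathcal B$ generated by its minimal projections, i.e. the nonzero projections $p$ with $p\mathcal Bp=\mathbb Cp$, and let $CCR(\mathcal B)$ be the ideal of all elements of $\mathcal B$ that every irreducible representation of $\mathcal B$ sends to a compact operator. The algebra $\mathcal A$ is scattered if $\mathcal I^{At}(\mathcal B)\neq\{0\}$ for every nonzero $C^*$-subalgebra $\mathcal B\subseteq\mathcal A$. Its Cantor–Bendixson sequence is given by $\mathcal I_0=\{0\}$, $\mathcal I_{\alpha+1}=\{a\in\mathcal A:[a]_{\mathcal I_\alpha}\in\mathcal I^{At}(\mathcal A/\mathcal I_\alpha)\}$ and $\mathcal I_\lambda=\overline{\bigcup_{\alpha<\lambda}\mathcal I_\alpha}$ for limit ordinals $\lambda$; its height $ht(\mathcal A)$ is the least ordinal $\alpha$ with $\mathcal I_{\alpha}=\mathcal A$. A scattered $C^*$-algebra $\mathcal A$ is fully noncommutative if for every $\alpha<ht(\mathcal A)$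 (i.e. as long as $\mathcal I_\alpha\ne\mathcal A$) the quotient $\mathcal I_{\alpha+1}/\mathcal I_\alpha$ is $*$-isomorphic to the algebra of all compact operators on a nonzero Hilbert space. A GCR composition series of $\mathcal A$ is a strictly increasing sequence of ideals $(\mathcal J_\alpha)_{\alpha\le\alpha_0}$, for some ordinal $\alpha_0$, such that $\mathcal J_0=\{0\}$, $\mathcal J_{\alpha_0}=\mathcal A$, $\mathcal J_\lambda=\overline{\bigcup_{\alpha<\lambda}\mathcal J_\alpha}$ for each limit ordinal $\lambda\le\alpha_0$, and $\{[a]_{\mathcal J_\alpha}:a\in\mathcal J_{\alpha+1}\}=CCR(\mathcal A/\mathcal J_\alpha)$ for each $\alpha<\alpha_0$. **Proposition.** Suppose that $\mathcal A$ is a fully noncommutative scattered $C^*$-algebra. Then its Cantor–Bendixson sequence and its GCR composition series coincide. That is: the Cantor–Bendixson sequence $(\mathcal I_\alpha)_{\alpha\le ht(\mathcal A)}$ is a strictly increasing continuous sequence of ideals from $\{0\}$ to $\mathcal A$, it is a GCR composition series of $\mathcal A$, and every GCR composition series $(\mathcal J_\alpha)_{\alpha\le\alpha_0}$ of $\mathcal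 A$ satisfies $\alpha_0=ht(\mathcal A)$ and $\mathcal J_\alpha=\mathcal I_\alpha$ for all $\alpha\le ht(\mathcal A)$. -/

import Mathlib

universe u

open Filter Topology

/-- A closed two-sided ideal of a (complex, not necessarily unital) C*-algebra. -/
structure ClosedIdeal (A : Type u) [NonUnitalCStarAlgebra A] extends Submodule ℂ A where
  mul_mem_left' : ∀ (a : A) {x : A}, x ∈ carrier → a * x ∈ carrier
  mul_mem_right' : ∀ (a : A) {x : A}, x ∈ carrier → x * a ∈ carrier
  isClosed' : IsClosed carrier

namespace ClosedIdeal

variable {A : Type u} [NonUnitalCStarAlgebra A]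

instance : SetLike (ClosedIdeal A) A where
  coe I := I.carrier
  coe_injective I J h := by
    cases I; cases J; congr; exact SetLike.coe_injective h

instance : AddSubgroupClass (ClosedIdeal A) A where
  add_mem {I} _ _ := I.toSubmodule.add_mem
  zero_mem I := I.toSubmodule.zero_mem
  neg_mem {I} _ := I.toSubmodule.neg_mem

@[ext] theorem ext {I J : ClosedIdeal A} (h : ∀ x, x ∈ I ↔ x ∈ J) : I = J := SetLike.ext h

theorem mem_toSubmodule {I : ClosedIdeal A} {x : A} : x ∈ I.toSubmodule ↔ x ∈ I := Iff.rfl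

variable (I : ClosedIdeal A)

theorem smul_mem (c : ℂ) {x : A} (hx : x ∈ I) : c • x ∈ I := I.toSubmodule.smul_mem c hx
theorem mul_mem_left (a : A) {x : A} (hx : x ∈ I) : a * x ∈ I := I.mul_mem_left' a hx
theorem mul_mem_right (a : A) {x : A} (hx : x ∈ I) : x * a ∈ I := I.mul_mem_right' a hx
theorem isClosed : IsClosed (I : Set A) := I.isClosed'

instance : IsClosed (I.toSubmodule : Set A) := I.isClosed'

/-- The ideal `{0}`. -/
instance : Bot (ClosedIdeal A) where
  bot :=
    { (⊥ : Submodule ℂ A) with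
      mul_mem_left' := by
        rintro a x (rfl : x = 0)
        exact mul_zero a
      mul_mem_right' := by
        rintro a x (rfl : x = 0)
        exact zero_mul a
      isClosed' := isClosed_singleton }

/-- The ideal `A`. -/
instance : Top (ClosedIdeal A) where
  top :=
    { (⊤ : Submodule ℂ A) with
      mul_mem_left' := fun _ _ _ => trivial
      mul_mem_right' := fun _ _ _ => trivial
      isClosed' := isClosed_univ }

theorem mem_bot {x : A} : x ∈ (⊥ : ClosedIdeal A) ↔ x = 0 := Iff.rfl
theorem mem_top {x : A} : x ∈ (⊤ : ClosedIdeal A) := trivial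

/-- Closed two-sided ideals of C*-algebras are self-adjoint. -/
theorem star_mem {x : A} (hx : x ∈ I) : star x ∈ I := by
  set h : A := star x * x with hh
  have hsa : star h = h := by simp [hh]
  have hI : h ∈ I := I.mul_mem_left _ hx
  have key : ∀ y ∈ NonUnitalStarAlgebra.adjoin ℂ ({h} : Set A), y ∈ I ∧ star y ∈ I := by
    intro y hy
    induction hy using NonUnitalStarAlgebra.adjoin_induction with
    | mem y hy =>
      obtain rfl : y = h := hy
      exact ⟨hI, by rwa [hsa]⟩
    | add y z _ _ h1 h2 =>
      exact ⟨add_mem h1.1 h2.1, by rw [star_add]; exact add_mem h1.2 h2.2⟩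
    | zero => exact ⟨zero_mem I, by rw [star_zero]; exact zero_mem I⟩
    | mul y z _ _ h1 h2 =>
      exact ⟨I.mul_mem_left _ h2.1, by rw [star_mul]; exact I.mul_mem_left _ h1.2⟩
    | smul c y _ h1 =>
      exact ⟨I.smul_mem c h1.1, by rw [star_smul]; exact I.smul_mem _ h1.2⟩
    | star y _ h1 => exact ⟨h1.2, by rw [star_star]; exact h1.1⟩
  let B := NonUnitalStarAlgebra.elemental ℂ h
  have hB : ∀ y ∈ B, y ∈ I := by
    intro y hy
    have hy' : y ∈ closure (NonUnitalStarAlgebra.adjoin ℂ ({h} : Set A) : Set A) := hy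
    exact I.isClosed.closure_subset_iff.2 (fun z hz => (key z hz).1) hy'
  let _ : PartialOrder B := CStarAlgebra.spectralOrder B
  have _ : StarOrderedRing B := CStarAlgebra.spectralOrderedRing B
  let l := CStarAlgebra.approximateUnit B
  have hl := CStarAlgebra.increasingApproximateUnit B
  let hb : B := ⟨h, NonUnitalStarAlgebra.elemental.self_mem ℂ h⟩
  have hs : ∀ᶠ e : B in l, star (e : A) = e := by
    filter_upwards [hl.eventually_star_eq] with e he
    exact congrArg Subtype.val he
  have t1 : Tendsto (fun e : B => (e : A) * h) l (𝓝 h) :=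
    (continuous_subtype_val.tendsto hb).comp (hl.tendsto_mul_right hb)
  have t2 : Tendsto (fun e : B => h * (e : A)) l (𝓝 h) :=
    (continuous_subtype_val.tendsto hb).comp (hl.tendsto_mul_left hb)
  have t3 : Tendsto (fun e : B => (e : A) * h * (e : A)) l (𝓝 h) := by
    rw [tendsto_iff_norm_sub_tendsto_zero]
    have t4 : Tendsto (fun e : B => ‖(e : A) * h - h‖ + ‖h * (e : A) - h‖) l (𝓝 0) := by
      simpa using (tendsto_iff_norm_sub_tendsto_zero.1 t1).add
        (tendsto_iff_norm_sub_tendsto_zero.1 t2)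
    refine squeeze_zero' (Eventually.of_forall fun _ => norm_nonneg _) ?_ t4
    filter_upwards [hl.eventually_norm] with e he
    have he' : ‖(e : A)‖ ≤ 1 := he
    calc ‖(e : A) * h * e - h‖ = ‖((e : A) * h - h) * e + (h * e - h)‖ := by
          congr 1; rw [sub_mul]; abel
      _ ≤ ‖((e : A) * h - h) * e‖ + ‖h * e - h‖ := norm_add_le _ _
      _ ≤ ‖(e : A) * h - h‖ + ‖h * e - h‖ := by
          gcongr
          exact (norm_mul_le _ _).trans (mul_le_of_le_one_right (norm_nonneg _) he')
  have t5 : Tendsto (fun e : B => h - h * (e : A) - (e : A) * h + (e : A) * h * (e : A)) l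
      (𝓝 0) := by
    simpa using (((tendsto_const_nhds (x := h)).sub t2).sub t1).add t3
  have t6 : Tendsto (fun e : B => (e : A) * star x) l (𝓝 (star x)) := by
    rw [tendsto_iff_norm_sub_tendsto_zero]
    have t7 := (continuous_norm.tendsto _).comp t5
    rw [norm_zero] at t7
    have t8 := (Real.continuous_sqrt.tendsto _).comp t7
    rw [Real.sqrt_zero] at t8
    refine t8.congr' ?_
    filter_upwards [hs] with e he
    have : h - h * (e : A) - (e : A) * h + (e : A) * h * (e : A)
        = ((e : A) * star x - star x) * star ((e : A) * star x - star x) := by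
      simp only [star_sub, star_mul, star_star, he, sub_mul, mul_sub, hh, mul_assoc]
      abel
    simp only [Function.comp, this]
    rw [CStarRing.norm_self_mul_star, Real.sqrt_mul_self (norm_nonneg _)]
  exact I.isClosed.mem_of_tendsto t6
    (Eventually.of_forall fun e => I.mul_mem_right _ (hB _ e.2))

/-- A closed ideal as a (closed) `*`-subalgebra. -/
def toStarSubalgebra : NonUnitalStarSubalgebra ℂ A where
  carrier := I
  add_mem' := add_mem
  zero_mem' := zero_mem I
  mul_mem' := fun _ hy => I.mul_mem_left _ hy
  smul_mem' := fun c _ hx => I.smul_mem c hx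
  star_mem' := fun hx => I.star_mem hx

instance : IsClosed (I.toStarSubalgebra : Set A) := I.isClosed'

/-- The quotient `A / I`, with the quotient norm. -/
def Quotient : Type u := A ⧸ I.toSubmodule

namespace Quotient

noncomputable instance : NormedAddCommGroup I.Quotient :=
  inferInstanceAs (NormedAddCommGroup (A ⧸ I.toSubmodule))

noncomputable instance : NormedSpace ℂ I.Quotient :=
  inferInstanceAs (NormedSpace ℂ (A ⧸ I.toSubmodule))

instance : CompleteSpace I.Quotient :=
  inferInstanceAs (CompleteSpace (A ⧸ I.toSubmodule))

/-- The class `[a]` of `a` in `A / I`. -/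
def mk (a : A) : I.Quotient := Submodule.Quotient.mk a

variable {I}

theorem mk_surjective : Function.Surjective (mk I) := Submodule.Quotient.mk_surjective _

theorem mk_eq_mk {a b : A} : mk I a = mk I b ↔ a - b ∈ I := Submodule.Quotient.eq _

instance : Mul I.Quotient where
  mul := Quotient.map₂ (· * ·) (by
    intro a a' ha b b' hb
    refine (Submodule.quotientRel_def _).2 ?_
    replace ha := (Submodule.quotientRel_def _).1 ha
    replace hb := (Submodule.quotientRel_def _).1 hb
    have : a * b - a' * b' = (a - a') * b + a' * (b - b') := by
      rw [sub_mul, mul_sub]; abel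
    rw [this]
    exact add_mem (I.mul_mem_right _ ha) (I.mul_mem_left _ hb))

instance : Star I.Quotient where
  star := Quotient.map star (by
    intro a a' ha
    refine (Submodule.quotientRel_def _).2 ?_
    replace ha := (Submodule.quotientRel_def _).1 ha
    rw [← star_sub]
    exact I.star_mem ha)

theorem mk_mul (a b : A) : mk I (a * b) = mk I a * mk I b := rfl
theorem mk_star (a : A) : mk I (star a) = star (mk I a) := rfl
theorem mk_add (a b : A) : mk I (a + b) = mk I a + mk I b := rfl
theorem mk_zero : mk I 0 = 0 := rfl
theorem mk_smul (c : ℂ) (a : A) : mk I (c • a) = c • mk I a := rfl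

theorem norm_mk_le (a : A) : ‖mk I a‖ ≤ ‖a‖ := Submodule.Quotient.norm_mk_le _ a

theorem exists_norm_lt (x : I.Quotient) {ε : ℝ} (hε : 0 < ε) :
    ∃ a, mk I a = x ∧ ‖a‖ < ‖x‖ + ε := Submodule.Quotient.norm_mk_lt x hε

theorem norm_mul_le' (x y : I.Quotient) : ‖x * y‖ ≤ ‖x‖ * ‖y‖ := by
  have key : ∀ ε : ℝ, 0 < ε → ‖x * y‖ ≤ (‖x‖ + ε) * (‖y‖ + ε) := by
    intro ε hε
    obtain ⟨a, rfl, ha⟩ := exists_norm_lt x hε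
    obtain ⟨b, rfl, hb⟩ := exists_norm_lt y hε
    rw [← mk_mul]
    exact (norm_mk_le _).trans ((norm_mul_le _ _).trans (by gcongr))
  have ht : Tendsto (fun ε : ℝ => (‖x‖ + ε) * (‖y‖ + ε)) (𝓝[>] 0) (𝓝 (‖x‖ * ‖y‖)) := by
    have : Continuous fun ε : ℝ => (‖x‖ + ε) * (‖y‖ + ε) := by fun_prop
    simpa using (this.tendsto 0).mono_left nhdsWithin_le_nhds
  exact ge_of_tendsto ht (by filter_upwards [self_mem_nhdsWithin] with ε hε using key ε hε)

/-- The C*-inequality for the quotient norm. -/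
theorem norm_mk_sq_le (x i : A) (hi : i ∈ I) :
    ‖mk I x‖ * ‖mk I x‖ ≤ ‖star x * x + i‖ := by
  let B := I.toStarSubalgebra
  let _ : PartialOrder B := CStarAlgebra.spectralOrder B
  have _ : StarOrderedRing B := CStarAlgebra.spectralOrderedRing B
  let _ : PartialOrder A := CStarAlgebra.spectralOrder A
  have _ : StarOrderedRing A := CStarAlgebra.spectralOrderedRing A
  let l := CStarAlgebra.approximateUnit B
  have hl := CStarAlgebra.increasingApproximateUnit B
  let ib : B := ⟨i, hi⟩
  have hs : ∀ᶠ e : B in l, star (e : A) = e := by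
    filter_upwards [hl.eventually_star_eq] with e he
    exact congrArg Subtype.val he
  have hpos : ∀ᶠ e : B in l, 0 ≤ (e : A) := by
    filter_upwards [hl.eventually_nonneg] with e he
    obtain ⟨b, rfl⟩ := CStarAlgebra.nonneg_iff_eq_star_mul_self.1 he
    exact star_mul_self_nonneg (b : A)
  have t1 : Tendsto (fun e : B => i - i * (e : A)) l (𝓝 0) := by
    have : Tendsto (fun e : B => i * (e : A)) l (𝓝 i) :=
      (continuous_subtype_val.tendsto ib).comp (hl.tendsto_mul_left ib)
    simpa using (tendsto_const_nhds (x := i)).sub this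
  have t2 : Tendsto (fun e : B => ‖star x * x + i‖ + 2 * ‖i - i * (e : A)‖) l
      (𝓝 ‖star x * x + i‖) := by
    simpa using tendsto_const_nhds.add ((t1.norm).const_mul 2)
  refine ge_of_tendsto t2 ?_
  filter_upwards [hs, hpos, hl.eventually_norm] with e he hep hen
  have he1 : ‖(e : A)‖ ≤ 1 := hen
  have contr : ‖(1 : Unitization ℂ A) - (e : A)‖ ≤ 1 := by
    have h1 : (((e : A) : A) : Unitization ℂ A) ∈ Set.Icc (0 : Unitization ℂ A) 1 :=
      CStarAlgebra.mem_Icc_iff_norm_le_one.2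
        ⟨Unitization.inr_nonneg_iff.2 hep, by rwa [Unitization.norm_inr]⟩
    exact (CStarAlgebra.mem_Icc_iff_norm_le_one.1
      (Set.sub_mem_Icc_zero_iff_right.mpr h1)).2
  have left : ∀ y : A, ‖y - (e : A) * y‖ ≤ ‖y‖ := by
    intro y
    have : ((y - (e : A) * y : A) : Unitization ℂ A) = (1 - ((e : A) : Unitization ℂ A)) * y := by
      simp [sub_mul]
    rw [← Unitization.norm_inr (𝕜 := ℂ), this]
    refine (norm_mul_le _ _).trans ?_
    rw [Unitization.norm_inr]
    exact mul_le_of_le_one_left (norm_nonneg _) contr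
  have right : ∀ y : A, ‖y - y * (e : A)‖ ≤ ‖y‖ := by
    intro y
    have := left (star y)
    rwa [← norm_star, star_sub, star_mul, star_star, he, norm_star] at this
  have hx : mk I x = mk I (x - x * e) := by
    rw [mk_eq_mk]
    simpa using I.mul_mem_left x e.2
  have expand : star (x - x * e) * (x - x * e)
      = (((star x * x + i) - (star x * x + i) * e) - e * ((star x * x + i) - (star x * x + i) * e))
        - ((i - i * e) - e * (i - i * e)) := by
    simp only [star_sub, star_mul, he, sub_mul, mul_sub, add_mul, mul_add, mul_assoc]
    abel
  calc ‖mk I x‖ * ‖mk I x‖ ≤ ‖x - x * e‖ * ‖x - x * e‖ := by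
        rw [hx]
        gcongr <;> exact norm_mk_le _
    _ = ‖star (x - x * e) * (x - x * e)‖ := CStarRing.norm_star_mul_self.symm
    _ ≤ _ := by
        rw [expand]
        refine (norm_sub_le _ _).trans ?_
        have a1 := (left ((star x * x + i) - (star x * x + i) * e)).trans (right _)
        have a2 := left (i - i * e)
        have a3 := norm_nonneg (i - i * (e : A))
        linarith

noncomputable instance : NonUnitalRing I.Quotient where
  left_distrib := by
    intro x y z
    obtain ⟨a, rfl⟩ := mk_surjective x
    obtain ⟨b, rfl⟩ := mk_surjective y
    obtain ⟨c, rfl⟩ := mk_surjective z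
    exact congrArg (mk I) (mul_add a b c)
  right_distrib := by
    intro x y z
    obtain ⟨a, rfl⟩ := mk_surjective x
    obtain ⟨b, rfl⟩ := mk_surjective y
    obtain ⟨c, rfl⟩ := mk_surjective z
    exact congrArg (mk I) (add_mul a b c)
  zero_mul := by
    intro x
    obtain ⟨a, rfl⟩ := mk_surjective x
    exact congrArg (mk I) (zero_mul a)
  mul_zero := by
    intro x
    obtain ⟨a, rfl⟩ := mk_surjective x
    exact congrArg (mk I) (mul_zero a)
  mul_assoc := by
    intro x y z
    obtain ⟨a, rfl⟩ := mk_surjective x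
    obtain ⟨b, rfl⟩ := mk_surjective y
    obtain ⟨c, rfl⟩ := mk_surjective z
    exact congrArg (mk I) (mul_assoc a b c)

noncomputable instance : NonUnitalNormedRing I.Quotient where
  dist_eq := NormedAddCommGroup.dist_eq
  norm_mul_le := norm_mul_le'

noncomputable instance : StarRing I.Quotient where
  star_involutive := by
    intro x
    obtain ⟨a, rfl⟩ := mk_surjective x
    exact congrArg (mk I) (star_star a)
  star_mul := by
    intro x y
    obtain ⟨a, rfl⟩ := mk_surjective x
    obtain ⟨b, rfl⟩ := mk_surjective y
    exact congrArg (mk I) (star_mul a b)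
  star_add := by
    intro x y
    obtain ⟨a, rfl⟩ := mk_surjective x
    obtain ⟨b, rfl⟩ := mk_surjective y
    exact congrArg (mk I) (star_add a b)

/-- The quotient of a C*-algebra by a closed ideal is a C*-algebra. -/
noncomputable instance : NonUnitalCStarAlgebra I.Quotient where
  norm_mul_self_le := by
    intro x
    obtain ⟨a, rfl⟩ := mk_surjective x
    refine le_of_forall_pos_le_add fun ε hε => ?_
    obtain ⟨b, hb, hlt⟩ := exists_norm_lt (star (mk I a) * mk I a) hε
    have hmem : b - star a * a ∈ I := mk_eq_mk.1 hb
    have := norm_mk_sq_le a _ hmem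
    rw [add_sub_cancel] at this
    exact this.trans hlt.le
  smul_assoc := by
    intro c x y
    obtain ⟨a, rfl⟩ := mk_surjective x
    obtain ⟨b, rfl⟩ := mk_surjective y
    exact congrArg (mk I) (smul_mul_assoc c a b)
  smul_comm := by
    intro c x y
    obtain ⟨a, rfl⟩ := mk_surjective x
    obtain ⟨b, rfl⟩ := mk_surjective y
    exact congrArg (mk I) (mul_smul_comm c a b).symm
  star_smul := by
    intro c x
    obtain ⟨a, rfl⟩ := mk_surjective x
    exact congrArg (mk I) (star_smul c a)

end Quotient

/-- The quotient map `A → A / I`. -/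
noncomputable def mkHom : A →⋆ₙₐ[ℂ] I.Quotient where
  toFun := Quotient.mk I
  map_smul' _ _ := rfl
  map_zero' := rfl
  map_add' _ _ := rfl
  map_mul' _ _ := rfl
  map_star' _ := rfl

theorem continuous_mkHom : Continuous I.mkHom :=
  AddMonoidHomClass.continuous_of_bound I.mkHom 1 fun a => by
    rw [one_mul]
    exact Quotient.norm_mk_le a

/-- The ideal `{a ∈ A : [a] ∈ K}` of `A`, for an ideal `K` of `A / I`. -/
noncomputable def pullback (K : ClosedIdeal I.Quotient) : ClosedIdeal A where
  carrier := {a | I.mkHom a ∈ K}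
  add_mem' := fun {a b} ha hb => by
    change I.mkHom (a + b) ∈ K
    rw [map_add]
    exact add_mem ha hb
  zero_mem' := by
    change I.mkHom 0 ∈ K
    rw [map_zero]
    exact zero_mem K
  smul_mem' := fun c a ha => by
    change I.mkHom (c • a) ∈ K
    rw [map_smul]
    exact K.smul_mem c ha
  mul_mem_left' := fun a x hx => by
    change I.mkHom (a * x) ∈ K
    rw [map_mul]
    exact K.mul_mem_left _ hx
  mul_mem_right' := fun a x hx => by
    change I.mkHom (x * a) ∈ K
    rw [map_mul]
    exact K.mul_mem_right _ hx
  isClosed' := K.isClosed.preimage I.continuous_mkHom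

/-- The quotient `J / I = {[a] : a ∈ J}`, as a `*`-subalgebra of `A / I`. -/
noncomputable def subquotient (J : ClosedIdeal A) : NonUnitalStarSubalgebra ℂ I.Quotient :=
  J.toStarSubalgebra.map I.mkHom

/-- The closed ideal generated by a family of closed ideals: the closure of its sum. For a
family that is linearly ordered by inclusion, the sum is the union. -/
def closedSup {ι : Type*} (K : ι → ClosedIdeal A) : ClosedIdeal A where
  toSubmodule := (⨆ i, (K i).toSubmodule).topologicalClosure
  mul_mem_left' := fun a x hx => by
    refine map_mem_closure (f := fun y => a * y) (by fun_prop) hx fun y hy => ?_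
    refine Submodule.iSup_induction _ (motive := fun y => a * y ∈ ⨆ i, (K i).toSubmodule) hy
      (fun i z hz => Submodule.mem_iSup_of_mem i ((K i).mul_mem_left a hz)) (by simp)
      fun y z h1 h2 => ?_
    rw [mul_add]
    exact add_mem h1 h2
  mul_mem_right' := fun a x hx => by
    refine map_mem_closure (f := fun y => y * a) (by fun_prop) hx fun y hy => ?_
    refine Submodule.iSup_induction _ (motive := fun y => y * a ∈ ⨆ i, (K i).toSubmodule) hy
      (fun i z hz => Submodule.mem_iSup_of_mem i ((K i).mul_mem_right a hz)) (by simp)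
      fun y z h1 h2 => ?_
    rw [add_mul]
    exact add_mem h1 h2
  isClosed' := Submodule.isClosed_topologicalClosure _

end ClosedIdeal

section Atoms

variable {A : Type u} [NonUnitalCStarAlgebra A]

/-- A (nonzero) projection `p` with `p A p = ℂ p`. -/
structure IsMinimalProjection (p : A) : Prop where
  isStarProjection : IsStarProjection p
  ne_zero : p ≠ 0
  exists_smul : ∀ a : A, ∃ c : ℂ, p * a * p = c • p

theorem IsMinimalProjection.of_star_mul_self {p x : A} (hp : IsMinimalProjection p) {r : ℂ}
    (hr0 : r ≠ 0) (hr : star r = r) (hxp : x * p = x) (hx : star x * x = r • p) :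
    IsMinimalProjection (r⁻¹ • (x * star x)) := by
  have hps : star p = p := hp.isStarProjection.isSelfAdjoint
  have hpx : p * star x = star x := by rw [← hps, ← star_mul, hxp]
  refine ⟨⟨?_, ?_⟩, ?_, ?_⟩
  · show r⁻¹ • (x * star x) * r⁻¹ • (x * star x) = r⁻¹ • (x * star x)
    have : x * star x * (x * star x) = r • (x * star x) := by
      calc x * star x * (x * star x) = x * (star x * x) * star x := by simp only [mul_assoc]
        _ = _ := by rw [hx, mul_smul_comm, smul_mul_assoc, hxp]
    rw [smul_mul_smul_comm, this, smul_smul]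
    congr 1
    field_simp
  · show star (r⁻¹ • (x * star x)) = _
    rw [star_smul, star_mul, star_star, star_inv₀, hr]
  · intro h0
    rw [smul_eq_zero] at h0
    rcases h0 with h0 | h0
    · exact hr0 (inv_eq_zero.1 h0)
    · have : x = 0 := CStarRing.mul_star_self_eq_zero_iff _ |>.1 h0
      rw [this, mul_zero] at hx
      exact (smul_ne_zero hr0 hp.ne_zero) hx.symm
  · intro a
    obtain ⟨c, hc⟩ := hp.exists_smul (star x * a * x)
    refine ⟨r⁻¹ * c, ?_⟩
    have : x * star x * a * (x * star x) = c • (x * star x) := by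
      calc x * star x * a * (x * star x) = (x * p) * (star x * a * x) * (p * star x) := by
            rw [hxp, hpx]; simp only [mul_assoc]
        _ = x * (p * (star x * a * x) * p) * star x := by simp only [mul_assoc]
        _ = _ := by rw [hc, mul_smul_comm, smul_mul_assoc, hxp]
    rw [smul_mul_assoc, smul_mul_assoc, mul_smul_comm, this, smul_smul, smul_smul, smul_smul]
    congr 1
    ring

theorem IsMinimalProjection.exists_nonneg {p : A} (hp : IsMinimalProjection p) (a : A) :
    ∃ r : ℝ, 0 ≤ r ∧ star (a * p) * (a * p) = (r : ℂ) • p := by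
  let _ : PartialOrder A := CStarAlgebra.spectralOrder A
  have _ : StarOrderedRing A := CStarAlgebra.spectralOrderedRing A
  have hps : star p = p := hp.isStarProjection.isSelfAdjoint
  have hpp : p * p = p := hp.isStarProjection.isIdempotentElem
  obtain ⟨c, hc⟩ := hp.exists_smul (star a * a)
  have hx : star (a * p) * (a * p) = c • p := by
    rw [← hc, star_mul, hps]; simp only [mul_assoc]
  have hcs : star c = c := by
    have h1 : star (c • p) = c • p := by rw [← hx]; simp
    rw [star_smul, hps] at h1
    exact smul_left_injective ℂ hp.ne_zero h1
  obtain ⟨r, rfl⟩ : ∃ r : ℝ, (r : ℂ) = c := ⟨c.re, Complex.conj_eq_iff_re.1 hcs⟩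
  rcases le_or_gt 0 r with h | h
  · exact ⟨r, h, hx⟩
  · exfalso
    have h1 : (0 : A) ≤ ((r : ℝ) : ℂ) • p := hx ▸ star_mul_self_nonneg _
    have h2 : (0 : A) ≤ -(((r : ℝ) : ℂ) • p) := by
      have h3 := star_mul_self_nonneg (((Real.sqrt (-r) : ℝ) : ℂ) • p)
      rw [star_smul, hps, smul_mul_smul_comm, hpp] at h3
      have h4 : star ((Real.sqrt (-r) : ℝ) : ℂ) * ((Real.sqrt (-r) : ℝ) : ℂ) = -(r : ℂ) := by
        rw [Complex.star_def, Complex.conj_ofReal, ← Complex.ofReal_mul,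
          Real.mul_self_sqrt (by linarith)]
        simp
      rwa [h4, neg_smul] at h3
    have h5 : ((r : ℝ) : ℂ) • p = 0 := le_antisymm (neg_nonneg.1 h2) h1
    rw [smul_eq_zero] at h5
    rcases h5 with h5 | h5
    · exact h.ne (by exact_mod_cast h5)
    · exact hp.ne_zero h5

theorem IsMinimalProjection.mul_mem_adjoin {p : A} (hp : IsMinimalProjection p) (a : A) :
    a * p ∈ NonUnitalStarAlgebra.adjoin ℂ {q : A | IsMinimalProjection q} := by
  set S := NonUnitalStarAlgebra.adjoin ℂ {q : A | IsMinimalProjection q}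
  have hS : ∀ q : A, IsMinimalProjection q → q ∈ S := fun q hq =>
    NonUnitalStarAlgebra.subset_adjoin ℂ _ hq
  have hps : star p = p := hp.isStarProjection.isSelfAdjoint
  have hpp : p * p = p := hp.isStarProjection.isIdempotentElem
  obtain ⟨r, hr, hx⟩ := hp.exists_nonneg a
  obtain ⟨c, hc⟩ := hp.exists_smul a
  have hxp : a * p * p = a * p := by rw [mul_assoc, hpp]
  rw [mul_assoc] at hc
  generalize a * p = x at *
  rcases hr.eq_or_lt with rfl | hr
  · have : x = 0 := by
      rw [Complex.ofReal_zero, zero_smul] at hx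
      exact CStarRing.star_mul_self_eq_zero_iff _ |>.1 hx
    rw [this]
    exact zero_mem S
  have hrC : (r : ℂ) ≠ 0 := by exact_mod_cast hr.ne'
  have hrs : star (r : ℂ) = r := Complex.conj_ofReal r
  have hpx : p * star x = star x := by rw [← hps, ← star_mul, hxp]
  have hxsp : star x * p = star c • p := by
    rw [← hps, ← star_mul, hc, star_smul]
  set q : A := (r : ℂ)⁻¹ • (x * star x) with hq
  have hqm : IsMinimalProjection q := hp.of_star_mul_self hrC hrs hxp hx
  have hqx : q * x = x := by
    rw [hq, smul_mul_assoc, mul_assoc, hx, mul_smul_comm, hxp, smul_smul,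
      inv_mul_cancel₀ hrC, one_smul]
  have hqp : q * p = ((r : ℂ)⁻¹ * star c) • x := by
    rw [hq, smul_mul_assoc, mul_assoc, hxsp, mul_smul_comm, hxp, smul_smul]
  by_cases h0 : c = 0
  · subst h0
    rw [zero_smul] at hc
    rw [star_zero, zero_smul] at hxsp
    rw [star_zero, mul_zero, zero_smul] at hqp
    set s : ℂ := (((Real.sqrt r)⁻¹ : ℝ) : ℂ) with hs
    have hs0 : s ≠ 0 := by
      have := (Real.sqrt_pos.2 hr).ne'
      rw [hs]
      exact_mod_cast inv_ne_zero this
    have hss : star s = s := Complex.conj_ofReal _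
    have hsr : s * s * r = 1 := by
      rw [hs, ← Complex.ofReal_mul, ← Complex.ofReal_mul, ← mul_inv, Real.mul_self_sqrt hr.le,
        inv_mul_cancel₀ hr.ne', Complex.ofReal_one]
    have hw1 : (p + s • x) * p = p + s • x := by
      rw [add_mul, hpp, smul_mul_assoc, hxp]
    have hw2 : star (p + s • x) * (p + s • x) = (2 : ℂ) • p := by
      rw [star_add, star_smul, hps, hss, add_mul, mul_add, mul_add, hpp, mul_smul_comm, hc,
        smul_mul_assoc, hxsp, smul_mul_smul_comm, hx, smul_smul, hsr, two_smul]
      simp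
    have hm := hp.of_star_mul_self (two_ne_zero) (by simp) hw1 hw2
    have hprod : q * ((2 : ℂ)⁻¹ • ((p + s • x) * star (p + s • x))) * p
        = ((2 : ℂ)⁻¹ * s) • x := by
      have h1 : star (p + s • x) * p = p := by
        rw [star_add, star_smul, hps, hss, add_mul, hpp, smul_mul_assoc, hxsp, smul_zero,
          add_zero]
      have h2 : q * (p + s • x) = s • x := by
        rw [mul_add, hqp, mul_smul_comm, hqx, zero_add]
      calc q * ((2 : ℂ)⁻¹ • ((p + s • x) * star (p + s • x))) * p
          = (2 : ℂ)⁻¹ • ((q * (p + s • x)) * (star (p + s • x) * p)) := by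
            rw [mul_smul_comm, smul_mul_assoc]; simp only [mul_assoc]
        _ = _ := by rw [h1, h2, smul_mul_assoc, hxp, smul_smul]
    have hmem : ((2 : ℂ)⁻¹ * s) • x ∈ S := by
      rw [← hprod]
      exact mul_mem (mul_mem (hS _ hqm) (hS _ hm)) (hS _ hp)
    have := SMulMemClass.smul_mem (s := S) ((2 : ℂ)⁻¹ * s)⁻¹ hmem
    rwa [smul_smul, inv_mul_cancel₀ (mul_ne_zero (by norm_num) hs0), one_smul] at this
  · have hne : (r : ℂ)⁻¹ * star c ≠ 0 :=
      mul_ne_zero (inv_ne_zero hrC) (star_ne_zero.2 h0)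
    have hmem : ((r : ℂ)⁻¹ * star c) • x ∈ S := by
      rw [← hqp]
      exact mul_mem (hS _ hqm) (hS _ hp)
    have := SMulMemClass.smul_mem (s := S) ((r : ℂ)⁻¹ * star c)⁻¹ hmem
    rwa [smul_smul, inv_mul_cancel₀ hne, one_smul] at this

theorem mul_mem_adjoin_minimalProjections {y : A}
    (hy : y ∈ NonUnitalStarAlgebra.adjoin ℂ {q : A | IsMinimalProjection q}) :
    ∀ a : A, a * y ∈ NonUnitalStarAlgebra.adjoin ℂ {q : A | IsMinimalProjection q} ∧
      y * a ∈ NonUnitalStarAlgebra.adjoin ℂ {q : A | IsMinimalProjection q} := by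
  induction hy using NonUnitalStarAlgebra.adjoin_induction with
  | mem p hp =>
    intro a
    refine ⟨IsMinimalProjection.mul_mem_adjoin hp a, ?_⟩
    have := star_mem (IsMinimalProjection.mul_mem_adjoin hp (star a))
    rwa [star_mul, star_star,
      (hp.isStarProjection.isSelfAdjoint : star p = p)] at this
  | add y z _ _ h1 h2 =>
    intro a
    rw [mul_add, add_mul]
    exact ⟨add_mem (h1 a).1 (h2 a).1, add_mem (h1 a).2 (h2 a).2⟩
  | zero =>
    intro a
    rw [mul_zero, zero_mul]
    exact ⟨zero_mem _, zero_mem _⟩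
  | mul y z hy hz h1 h2 =>
    intro a
    rw [← mul_assoc, mul_assoc y]
    exact ⟨mul_mem (h1 a).1 hz, mul_mem hy (h2 a).2⟩
  | smul c y _ h1 =>
    intro a
    rw [mul_smul_comm, smul_mul_assoc]
    exact ⟨SMulMemClass.smul_mem c (h1 a).1, SMulMemClass.smul_mem c (h1 a).2⟩
  | star y _ h1 =>
    intro a
    have h2 := star_mem (h1 (star a)).1
    have h3 := star_mem (h1 (star a)).2
    rw [star_mul, star_star] at h2 h3
    exact ⟨h3, h2⟩

variable (A)

/-- `I^At(A)`: the C*-subalgebra (norm-closed `*`-subalgebra) of `A` generated by the minimal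
projections of `A`. -/
noncomputable def atomicSubalgebra : NonUnitalStarSubalgebra ℂ A :=
  (NonUnitalStarAlgebra.adjoin ℂ {p : A | IsMinimalProjection p}).topologicalClosure

/-- `I^At(A)`, as a closed ideal of `A`. -/
noncomputable def atomicIdeal : ClosedIdeal A where
  carrier := atomicSubalgebra A
  add_mem' := add_mem
  zero_mem' := zero_mem _
  smul_mem' := fun c _ hx => SMulMemClass.smul_mem c hx
  mul_mem_left' := fun a x hx =>
    map_mem_closure (f := fun y => a * y) (by fun_prop) hx fun _ hy =>
      (mul_mem_adjoin_minimalProjections hy a).1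
  mul_mem_right' := fun a x hx =>
    map_mem_closure (f := fun y => y * a) (by fun_prop) hx fun _ hy =>
      (mul_mem_adjoin_minimalProjections hy a).2
  isClosed' := NonUnitalStarSubalgebra.isClosed_topologicalClosure _

/-- `A` is scattered if `I^At(B) ≠ {0}` for every nonzero C*-subalgebra `B` of `A`. -/
def IsScattered : Prop :=
  ∀ (B : NonUnitalStarSubalgebra ℂ A) [IsClosed (B : Set A)], B ≠ ⊥ → atomicIdeal B ≠ ⊥

end Atoms

section Compact

/-- The algebra `K(H)` of compact operators on a Hilbert space, as a closed ideal of `B(H)`. -/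
def compactIdeal (H : Type u) [NormedAddCommGroup H] [InnerProductSpace ℂ H] [CompleteSpace H] :
    ClosedIdeal (H →L[ℂ] H) where
  carrier := {T | IsCompactOperator T}
  add_mem' := fun hS hT => IsCompactOperator.add hS hT
  zero_mem' := isCompactOperator_zero
  smul_mem' := fun c _ hT => IsCompactOperator.smul hT c
  mul_mem_left' := fun S _ hT => IsCompactOperator.clm_comp hT S
  mul_mem_right' := fun S _ hT => IsCompactOperator.comp_clm hT S
  isClosed' := isClosed_setOfPred_isCompactOperator

variable {A : Type u} [NonUnitalCStarAlgebra A]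

/-- A representation is irreducible if the only closed invariant subspaces are the trivial ones. -/
def IsIrreducibleRep {H : Type u} [NormedAddCommGroup H] [InnerProductSpace ℂ H] [CompleteSpace H]
    (π : A →⋆ₙₐ[ℂ] (H →L[ℂ] H)) : Prop :=
  ∀ V : Submodule ℂ H, IsClosed (V : Set H) → (∀ a : A, ∀ v ∈ V, π a v ∈ V) → V = ⊥ ∨ V = ⊤

variable (A)

/-- `CCR(A)`: the ideal of all elements that every irreducible representation of `A` on a Hilbert
space sends to a compact operator. Every irreducible representation is cyclic, hence unitarily
equivalent to one on a Hilbert space in the universe of `A`. -/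
def ccrIdeal : ClosedIdeal A where
  carrier := {a | ∀ (H : Type u) [NormedAddCommGroup H] [InnerProductSpace ℂ H]
    [CompleteSpace H] (π : A →⋆ₙₐ[ℂ] (H →L[ℂ] H)), IsIrreducibleRep π → π a ∈ compactIdeal H}
  add_mem' := fun {a b} ha hb H _ _ _ π hπ => by
    rw [map_add]
    exact add_mem (ha H π hπ) (hb H π hπ)
  zero_mem' := fun H _ _ _ π hπ => by
    rw [map_zero]
    exact zero_mem _
  smul_mem' := fun c a ha H _ _ _ π hπ => by
    rw [map_smul]
    exact (compactIdeal H).smul_mem c (ha H π hπ)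
  mul_mem_left' := fun b a ha H _ _ _ π hπ => by
    rw [map_mul]
    exact (compactIdeal H).mul_mem_left _ (ha H π hπ)
  mul_mem_right' := fun b a ha H _ _ _ π hπ => by
    rw [map_mul]
    exact (compactIdeal H).mul_mem_right _ (ha H π hπ)
  isClosed' := by
    simp only [Set.ofPred_forall]
    exact isClosed_iInter fun H => isClosed_iInter fun _ => isClosed_iInter fun _ =>
      isClosed_iInter fun _ => isClosed_iInter fun π => isClosed_iInter fun _ =>
        (compactIdeal H).isClosed.preimage
          (AddMonoidHomClass.continuous_of_bound π 1 fun a => by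
            rw [one_mul]
            exact NonUnitalStarAlgHom.norm_apply_le π a)

end Compact

section Series

variable (A : Type u) [NonUnitalCStarAlgebra A]

/-- The Cantor-Bendixson sequence of `A`: `I₀ = {0}`, `I_{α+1} = {a : [a] ∈ I^At(A / I_α)}`, and
`I_λ` is the closure of `⋃ α < λ, I_α` at limit ordinals `λ`. It is defined at all ordinals. -/
noncomputable def cbIdeal (α : Ordinal.{u}) : ClosedIdeal A :=
  Ordinal.limitRecOn α ⊥
    (fun _ I => I.pullback (atomicIdeal I.Quotient))
    (fun l _ I => ClosedIdeal.closedSup fun β : Set.Iio l => I β.1 β.2)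

/-- The Cantor-Bendixson height `ht(A)`: the least ordinal `α` with `I_α = A`. -/
noncomputable def cbHeight : Ordinal.{u} := sInf {α | cbIdeal A α = ⊤}

/-- A scattered C*-algebra is fully noncommutative if, for each `α` below its Cantor-Bendixson
height (that is, as long as `I_α ≠ A`), `I_{α+1} / I_α` is `*`-isomorphic to the algebra of all
compact operators on a (nonzero) Hilbert space. -/
def IsFullyNoncommutative : Prop :=
  IsScattered A ∧ ∀ α : Ordinal.{u}, cbIdeal A α ≠ ⊤ →
    ∃ (H : Type u) (_ : NormedAddCommGroup H) (_ : InnerProductSpace ℂ H) (_ : CompleteSpace H),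
      Nontrivial H ∧
        Nonempty ((cbIdeal A α).subquotient (cbIdeal A (α + 1)) ≃⋆ₐ[ℂ]
          (compactIdeal H).toStarSubalgebra)

variable {A}

/-- `(J_α)_{α ≤ γ}` is a strictly increasing continuous sequence of closed ideals from `{0}` to
`A` such that `{[a] : a ∈ J_{α+1}} = D(A / J_α)` for all `α < γ`. Only the values `J α` with
`α ≤ γ` matter. -/
structure IsCompositionSeries (D : ∀ (B : Type u) [NonUnitalCStarAlgebra B], ClosedIdeal B)
    (γ : Ordinal.{u}) (J : Ordinal.{u} → ClosedIdeal A) : Prop where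
  zero : J 0 = ⊥
  top : J γ = ⊤
  strictMono : ∀ α β, α < β → β ≤ γ → (J α : Set A) ⊂ J β
  limit : ∀ l ≤ γ, Order.IsSuccLimit l → (J l : Set A) = closure (⋃ α < l, (J α : Set A))
  succ : ∀ α < γ, (J α).mkHom '' (J (α + 1)) = (D (J α).Quotient : Set (J α).Quotient)

/-- `(J_α)_{α ≤ γ}` is the Cantor-Bendixson sequence of `A`. -/
def IsCantorBendixsonSeries (γ : Ordinal.{u}) (J : Ordinal.{u} → ClosedIdeal A) : Prop :=
  IsCompositionSeries (fun B _ => atomicIdeal B) γ J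

/-- `(J_α)_{α ≤ γ}` is a GCR composition series of `A`. -/
def IsGCRSeries (γ : Ordinal.{u}) (J : Ordinal.{u} → ClosedIdeal A) : Prop :=
  IsCompositionSeries (fun B _ => ccrIdeal B) γ J

end Series

/-! ### Irreducible representations, minimal projections and compact operators -/

section Representations

/-! Everything reduces to `CCR(B) = I^At(B)` for `B = A / I_α`, as long as `I_α ≠ A`. Granted this,
the two series obey the same recursion and agree by transfinite induction.

An irreducible representation sends a minimal projection to an operator of rank at most one, so
`I^At(B) ⊆ CCR(B)`. For the converse, full noncommutativity gives a faithful representation `φ` of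
`I^At(B)` onto the compact operators of some `H ≠ 0`. It extends to a representation `π` of `B`
(`ClosedIdeal.exists_extension`), which is irreducible because its range contains the compacts. For
`b ∈ CCR(B)` the operator `π b` is compact, so `π b = φ a` with `a ∈ I^At(B)`, and `b - a` lies in
`ker π`. That kernel meets `I^At(B)` only in zero, so `b = a` once `I^At(B)` is known to be
essential.

Essentiality is `mem_cbIdeal_of_mem_of_inter`. If an ideal `N` meets `I_{α+1}` only inside `I_α` but
meets some later `I_{β+1}` in more, then `N` contains a representative of a minimal projection of `A
/ I_β`. Inductively `N ∩ I_β ⊆ I_α`, so it also represents a minimal projection of `A / I_α`, which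
forces it into `I_{α+1}`: a contradiction. Since the sequence reaches `A`, it follows that `N ⊆
I_α`. -/

theorem isCompactOperator_rankOne {H : Type*} [NormedAddCommGroup H] [InnerProductSpace ℂ H]
    (x y : H) :
    IsCompactOperator (InnerProductSpace.rankOne ℂ x y) := by
  have h : IsCompactOperator (innerSL ℂ y) :=
    isCompactOperator_of_locallyCompactSpace_dom (innerSL ℂ y)
  exact h.clm_comp (ContinuousLinearMap.toSpanSingleton ℂ x)

variable {B : Type u} [NonUnitalCStarAlgebra B]
  {H : Type u} [NormedAddCommGroup H] [InnerProductSpace ℂ H] [CompleteSpace H]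

theorem NonUnitalStarAlgHom.continuous_of_cstar (π : B →⋆ₙₐ[ℂ] (H →L[ℂ] H)) : Continuous π :=
  AddMonoidHomClass.continuous_of_bound π 1 fun a => by
    rw [one_mul]
    exact NonUnitalStarAlgHom.norm_apply_le π a

/-- The vectors of the form `π a v` are dense if `v` is not annihilated by `π`. -/
theorem IsIrreducibleRep.dense_orbit {π : B →⋆ₙₐ[ℂ] (H →L[ℂ] H)} (hπ : IsIrreducibleRep π)
    {v : H} {b : B} (hv : π b v ≠ 0) (w : H) : w ∈ closure (Set.range fun a => π a v) := by
  -- Without a unit the orbit of `v` need not visibly contain `v`; the nonzero vector `π b v` is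
  -- what excludes a zero closure.
  let V₀ : Submodule ℂ H :=
    { carrier := Set.range fun a => π a v
      add_mem' := by
        rintro _ _ ⟨a, rfl⟩ ⟨c, rfl⟩
        exact ⟨a + c, by simp⟩
      zero_mem' := ⟨0, by simp⟩
      smul_mem' := by
        rintro c _ ⟨a, rfl⟩
        exact ⟨c • a, by simp⟩ }
  have hinv : ∀ a : B, ∀ x ∈ V₀.topologicalClosure, π a x ∈ V₀.topologicalClosure := by
    intro a x hx
    refine map_mem_closure (f := fun y => π a y) (by fun_prop) hx ?_
    rintro _ ⟨c, rfl⟩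
    exact ⟨a * c, by simp⟩
  rcases hπ _ V₀.isClosed_topologicalClosure hinv with h | h
  · have : π b v ∈ V₀.topologicalClosure := V₀.le_topologicalClosure ⟨b, rfl⟩
    rw [h] at this
    exact absurd this hv
  · have : w ∈ V₀.topologicalClosure := h ▸ Submodule.mem_top
    exact this

/-- An irreducible representation sends minimal projections to operators of rank at most one. -/
theorem IsMinimalProjection.isCompactOperator_apply {p : B} (hp : IsMinimalProjection p)
    {π : B →⋆ₙₐ[ℂ] (H →L[ℂ] H)} (hπ : IsIrreducibleRep π) : IsCompactOperator (π p) := by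
  by_cases h0 : π p = 0
  · rw [h0]
    exact isCompactOperator_zero
  obtain ⟨x, hx⟩ : ∃ x, π p x ≠ 0 := by
    by_contra! h
    exact h0 (ContinuousLinearMap.ext h)
  have hpp : p * p = p := hp.isStarProjection.isIdempotentElem
  have hv : π p (π p x) = π p x := by
    rw [← mul_apply_eq_comp, ← map_mul, hpp]
  -- On the orbit of `π p x`, `π p` acts through `p * a * p = c • p` and lands in one line. The
  -- orbit is dense and the line closed, so this holds for every vector.
  have hspan : ∀ w, π p w ∈ ℂ ∙ π p x := by
    intro w
    have hcl : IsClosed ((ℂ ∙ π p x : Submodule ℂ H) : Set H) :=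
      Submodule.closed_of_finiteDimensional _
    have hd := hπ.dense_orbit (v := π p x) (b := p) (by rwa [hv]) w
    have := map_mem_closure (f := fun y => π p y) (t := (ℂ ∙ π p x : Submodule ℂ H))
      (by fun_prop) hd (by
        rintro _ ⟨a, rfl⟩
        obtain ⟨c, hc⟩ := hp.exists_smul a
        refine Submodule.mem_span_singleton.2 ⟨c, ?_⟩
        have h1 : π (p * a * p) x = c • π p x := by
          rw [hc, map_smul]
          rfl
        rw [← h1]
        simp)
    rwa [hcl.closure_eq] at this
  have hc : IsCompactOperator ((π p).codRestrict (ℂ ∙ π p x) hspan) := by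
    have : LocallyCompactSpace (ℂ ∙ π p x : Submodule ℂ H) :=
      have := FiniteDimensional.proper ℂ (ℂ ∙ π p x : Submodule ℂ H)
      inferInstance
    exact isCompactOperator_of_locallyCompactSpace_dom ((π p).codRestrict (ℂ ∙ π p x) hspan)
  exact hc.clm_comp (Submodule.subtypeL (ℂ ∙ π p x))

/-- The target is a closed self-adjoint ideal, so only the generating minimal projections need
checking. -/
theorem atomicIdeal_subset_ccrIdeal {b : B} (hb : b ∈ atomicIdeal B) : b ∈ ccrIdeal B := by
  refine (ccrIdeal B).isClosed.closure_subset_iff.2 ?_ (show b ∈ closure _ from hb)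
  intro y hy
  induction hy using NonUnitalStarAlgebra.adjoin_induction with
  | mem p hp => exact fun _ _ _ _ π hπ => IsMinimalProjection.isCompactOperator_apply hp hπ
  | add y z _ _ h1 h2 => exact add_mem h1 h2
  | zero => exact zero_mem _
  | mul y z _ _ h1 h2 => exact (ccrIdeal B).mul_mem_left _ h2
  | smul c y _ h1 => exact (ccrIdeal B).smul_mem c h1
  | star y _ h1 => exact (ccrIdeal B).star_mem h1

open InnerProductSpace in
/-- A faithful representation of an ideal whose range contains the operators of rank one extends
to a representation of the algebra. -/
theorem ClosedIdeal.exists_extension [Nontrivial H] (J : ClosedIdeal B)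
    (φ : J.toStarSubalgebra →⋆ₙₐ[ℂ] (H →L[ℂ] H)) (hφ : Function.Injective φ)
    (hrank : ∀ x y : H, ∃ a, φ a = rankOne ℂ x y) :
    ∃ π : B →⋆ₙₐ[ℂ] (H →L[ℂ] H), ∀ x : J.toStarSubalgebra, π x = φ x := by
  obtain ⟨v, hv⟩ := exists_norm_eq H (zero_le_one (α := ℝ))
  have hvv : inner ℂ v v = (1 : ℂ) := by
    rw [inner_self_eq_norm_sq_to_K, hv]; simp
  have hR : ∀ h : H, rankOne ℂ h v v = h := fun h => by
    rw [rankOne_apply, hvv, one_smul]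
  -- The operators `rankOne h v` form a column, a copy of `H` inside the range of `φ`. The algebra
  -- acts on `J` by left multiplication; restricted to this column, that is the desired action on
  -- `H`.
  choose j hj using fun h => hrank h v
  let m : B → J.toStarSubalgebra → J.toStarSubalgebra := fun b x => ⟨b * x, J.mul_mem_left b x.2⟩
  have hm_assoc : ∀ b x y, m b x * y = m b (x * y) := fun b x y => Subtype.ext (mul_assoc _ _ _)
  let P : B → H → H := fun b h => φ (m b (j h)) v
  -- Left multiplication preserves the column: `j h = j h * j v`, and anything times `rankOne v v`
  -- is again of the form `rankOne _ v`.
  have key : ∀ b h, m b (j h) = j (P b h) := by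
    intro b h
    have h1 : j h = j h * j v := hφ <| by
      rw [map_mul, hj, hj]
      ext x
      rw [mul_apply_eq_comp, rankOne_apply, rankOne_apply, rankOne_apply, inner_smul_right, hvv,
        mul_one]
    have h2 : φ (m b (j h)) = φ (m b (j h)) * rankOne ℂ v v := by
      rw [← hj v, ← map_mul, hm_assoc, ← h1]
    apply hφ
    rw [hj, h2]
    ext x
    rw [mul_apply_eq_comp, rankOne_apply, rankOne_apply, map_smul]
  have hjv : ∀ h, φ (j h) v = h := fun h => by rw [hj, hR]
  have hjadd : ∀ h k, j (h + k) = j h + j k := fun h k => hφ <| by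
    rw [map_add, hj, hj, hj, map_add, add_apply]
  have hjsmul : ∀ (c : ℂ) h, j (c • h) = c • j h := fun c h => hφ <| by
    rw [map_smul, hj, hj, map_smul, smul_apply]
  have hm_add : ∀ b x y, m b (x + y) = m b x + m b y := fun b x y => Subtype.ext (mul_add _ _ _)
  have hm_smul : ∀ b (c : ℂ) x, m b (c • x) = c • m b x :=
    fun b c x => Subtype.ext (mul_smul_comm _ _ _)
  -- An injective `*`-homomorphism is isometric and `v` is a unit vector, hence `j` is isometric.
  have hPbd : ∀ b h, ‖P b h‖ ≤ ‖b‖ * ‖h‖ := by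
    intro b h
    have h3 : ‖j h‖ = ‖h‖ := by
      rw [← NonUnitalStarAlgHom.norm_map φ hφ, hj, norm_rankOne, hv, mul_one]
    calc ‖P b h‖ ≤ ‖φ (m b (j h))‖ * ‖v‖ := ContinuousLinearMap.le_opNorm _ _
      _ = ‖m b (j h)‖ := by rw [hv, mul_one, NonUnitalStarAlgHom.norm_map φ hφ]
      _ ≤ ‖b‖ * ‖j h‖ := norm_mul_le b (j h : B)
      _ = ‖b‖ * ‖h‖ := by rw [h3]
  -- The inner product on `H` is the coefficient at `v` of `star (j h) * j k`, so adjointness is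
  -- associativity in `B`.
  have hPstar : ∀ b h k, inner ℂ (P (star b) h) k = inner ℂ h (P b k) := by
    intro b h k
    have h1 : star (m (star b) (j h)) * j k = star (j h) * m b (j k) := Subtype.ext (by
      change star (star b * (j h : B)) * j k = star (j h : B) * (b * j k)
      rw [star_mul, star_star, mul_assoc])
    have h2 := congrArg (fun T => inner ℂ v (T v)) (congrArg φ h1)
    simp only [map_mul, map_star, mul_apply_eq_comp, ContinuousLinearMap.star_eq_adjoint,
      ContinuousLinearMap.adjoint_inner_right, hjv] at h2
    exact h2
  let π : B → (H →L[ℂ] H) := fun b => LinearMap.mkContinuous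
    { toFun := P b
      map_add' := fun h k => by
        simp only [P, hjadd, hm_add, map_add, add_apply]
      map_smul' := fun c h => by
        simp only [P, hjsmul, hm_smul, map_smul, smul_apply, RingHom.id_apply] }
    ‖b‖ (hPbd b)
  have hπ : ∀ b h, π b h = P b h := fun _ _ => rfl
  refine ⟨{ toFun := π, map_smul' := ?_, map_zero' := ?_, map_add' := ?_, map_mul' := ?_,
            map_star' := ?_ }, ?_⟩
  · intro c b
    ext h
    have : m (c • b) (j h) = c • m b (j h) := Subtype.ext (smul_mul_assoc _ _ _)
    change P (c • b) h = c • P b h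
    simp only [P, this, map_smul, smul_apply]
  · ext h
    have : m 0 (j h) = 0 := Subtype.ext (zero_mul _)
    change P 0 h = 0
    simp only [P, this, map_zero, zero_apply]
  · intro a b
    ext h
    have : m (a + b) (j h) = m a (j h) + m b (j h) := Subtype.ext (add_mul _ _ _)
    change P (a + b) h = P a h + P b h
    simp only [P, this, map_add, add_apply]
  · intro a b
    ext h
    have : m (a * b) (j h) = m a (j (P b h)) := by
      rw [← key]
      exact Subtype.ext (mul_assoc _ _ _)
    exact congrArg (fun x => φ x v) this
  · intro b
    rw [ContinuousLinearMap.star_eq_adjoint, ContinuousLinearMap.eq_adjoint_iff]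
    exact hPstar b
  · intro x
    ext h
    have h1 : m x (j h) = x * j h := rfl
    change φ (m x (j h)) v = _
    rw [h1, map_mul, mul_apply_eq_comp, hjv]

/-- A representation whose range contains the compact operators is irreducible. -/
theorem isIrreducibleRep_of_compact {π : B →⋆ₙₐ[ℂ] (H →L[ℂ] H)}
    (h : ∀ T ∈ compactIdeal H, ∃ b, π b = T) : IsIrreducibleRep π := by
  intro V _ hinv
  by_cases hV : V = ⊥
  · exact Or.inl hV
  refine Or.inr (eq_top_iff.2 fun w _ => ?_)
  obtain ⟨v, hvV, hv⟩ := V.exists_mem_ne_zero_of_ne_bot hV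
  -- This operator carries `v` to a nonzero multiple of the arbitrary vector `w`.
  obtain ⟨b, hb⟩ := h _ (isCompactOperator_rankOne w v)
  have h1 := hinv b v hvV
  rw [hb, InnerProductSpace.rankOne_apply] at h1
  have h2 := V.smul_mem (inner ℂ v v)⁻¹ h1
  rwa [smul_smul, inv_mul_cancel₀ (inner_self_ne_zero.2 hv), one_smul] at h2

/-- The kernel of a representation. -/
def ClosedIdeal.ker (π : B →⋆ₙₐ[ℂ] (H →L[ℂ] H)) : ClosedIdeal B where
  carrier := {b | π b = 0}
  add_mem' := fun {a b} ha hb => by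
    rw [Set.mem_ofPred_eq] at *
    rw [map_add, ha, hb, add_zero]
  zero_mem' := map_zero π
  smul_mem' := fun c a ha => by
    rw [Set.mem_ofPred_eq] at *
    rw [map_smul, ha, smul_zero]
  mul_mem_left' := fun a x hx => by
    rw [Set.mem_ofPred_eq] at *
    rw [map_mul, hx, mul_zero]
  mul_mem_right' := fun a x hx => by
    rw [Set.mem_ofPred_eq] at *
    rw [map_mul, hx, zero_mul]
  isClosed' := isClosed_singleton.preimage π.continuous_of_cstar

/-- If `I^At(B)` has a faithful representation onto the compact operators and meets every nonzero
ideal of `B`, then it is `CCR(B)`. -/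
theorem ccrIdeal_eq_atomicIdeal [Nontrivial H]
    (φ : (atomicIdeal B).toStarSubalgebra →⋆ₙₐ[ℂ] (H →L[ℂ] H)) (hφ : Function.Injective φ)
    (hrange : ∀ T : H →L[ℂ] H, IsCompactOperator T → ∃ a, φ a = T)
    (hess : ∀ N : ClosedIdeal B, (∀ x ∈ N, x ∈ atomicIdeal B → x = 0) → ∀ x ∈ N, x = 0) :
    ccrIdeal B = atomicIdeal B := by
  refine ClosedIdeal.ext fun b => ⟨fun hb => ?_, atomicIdeal_subset_ccrIdeal⟩
  obtain ⟨π, hπ⟩ := (atomicIdeal B).exists_extension φ hφ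
    fun x y => hrange _ (isCompactOperator_rankOne x y)
  have hirr : IsIrreducibleRep π := isIrreducibleRep_of_compact fun T hT => by
    obtain ⟨a, ha⟩ := hrange T hT
    exact ⟨a, (hπ a).trans ha⟩
  obtain ⟨a, ha⟩ := hrange (π b) (hb H π hirr)
  -- `π` extends the injective `φ`, so its kernel meets the atomic ideal trivially.
  have h0 := hess (ClosedIdeal.ker π)
    (fun x hx hxa => by
      have h1 : φ ⟨x, hxa⟩ = φ 0 := by
        rw [map_zero]
        exact (hπ ⟨x, hxa⟩).symm.trans hx
      exact congrArg Subtype.val (hφ h1))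
    (b - a) (by
      change π (b - a) = 0
      rw [map_sub, hπ, ha, sub_self])
  rw [sub_eq_zero.1 h0]
  exact a.2

end Representations

/-! ### Basic properties of the Cantor–Bendixson sequence -/

section Sequence

variable (A : Type u) [NonUnitalCStarAlgebra A]

theorem cbIdeal_zero : cbIdeal A 0 = ⊥ := Ordinal.limitRecOn_zero ..

theorem cbIdeal_add_one (α : Ordinal.{u}) :
    cbIdeal A (α + 1) = (cbIdeal A α).pullback (atomicIdeal (cbIdeal A α).Quotient) :=
  Ordinal.limitRecOn_add_one ..

theorem cbIdeal_limit {l : Ordinal.{u}} (hl : Order.IsSuccLimit l) :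
    cbIdeal A l = ClosedIdeal.closedSup fun β : Set.Iio l => cbIdeal A β.1 :=
  Ordinal.limitRecOn_limit _ _ _ _ hl

theorem mem_cbIdeal_add_one {α : Ordinal.{u}} {a : A} :
    a ∈ cbIdeal A (α + 1) ↔ (cbIdeal A α).mkHom a ∈ atomicIdeal (cbIdeal A α).Quotient := by
  rw [cbIdeal_add_one]
  rfl

theorem ClosedIdeal.mkHom_eq_zero {A : Type u} [NonUnitalCStarAlgebra A] {I : ClosedIdeal A}
    {a : A} : I.mkHom a = 0 ↔ a ∈ I := by
  rw [← map_zero I.mkHom]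
  exact Quotient.mk_eq_mk.trans (by rw [sub_zero])

theorem ClosedIdeal.mkHom_surjective {A : Type u} [NonUnitalCStarAlgebra A] (I : ClosedIdeal A) :
    Function.Surjective I.mkHom := Quotient.mk_surjective

theorem ClosedIdeal.le_closedSup {A : Type u} [NonUnitalCStarAlgebra A] {ι : Type*}
    (K : ι → ClosedIdeal A) (i : ι) {a : A} (ha : a ∈ K i) : a ∈ closedSup K :=
  Submodule.le_topologicalClosure _ (Submodule.mem_iSup_of_mem i ha)

theorem cbIdeal_mono : ∀ β α : Ordinal.{u}, α ≤ β → ∀ a ∈ cbIdeal A α, a ∈ cbIdeal A β := by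
  intro β
  induction β using Ordinal.limitRecOn with
  | zero =>
    intro α hα a ha
    rwa [nonpos_iff_eq_zero.1 hα] at ha
  | add_one β ih =>
    intro α hα a ha
    rcases hα.eq_or_lt with rfl | hα
    · exact ha
    · rw [mem_cbIdeal_add_one, ClosedIdeal.mkHom_eq_zero.2 (ih α (Order.lt_add_one_iff.1 hα) a ha)]
      exact zero_mem _
  | limit β hβ ih =>
    intro α hα a ha
    rcases hα.eq_or_lt with rfl | hα
    · exact ha
    · rw [cbIdeal_limit A hβ]
      exact ClosedIdeal.le_closedSup (fun γ : Set.Iio β => cbIdeal A γ.1) ⟨α, hα⟩ ha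

/-- The sum of a nonempty directed family of subspaces is its union; monotonicity supplies
directedness. -/
theorem coe_cbIdeal_limit {l : Ordinal.{u}} (hl : Order.IsSuccLimit l) :
    (cbIdeal A l : Set A) = closure (⋃ α < l, (cbIdeal A α : Set A)) := by
  rw [cbIdeal_limit A hl]
  change closure ((⨆ β : Set.Iio l, (cbIdeal A β.1).toSubmodule : Submodule ℂ A) : Set A) = _
  have : Nonempty (Set.Iio l) := ⟨⟨0, hl.bot_lt⟩⟩
  have hdir : Directed (· ≤ ·) fun β : Set.Iio l => (cbIdeal A β.1).toSubmodule := by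
    refine Monotone.directed_le fun β γ h a ha => cbIdeal_mono A _ _ h a ha
  congr 1
  rw [Submodule.coe_iSup_of_directed _ hdir]
  ext a
  simp only [Set.mem_iUnion, Subtype.exists, Set.mem_Iio]
  rfl

variable {A}

theorem cbIdeal_add_one_ne_self {α : Ordinal.{u}}
    (h : ∃ x ∈ atomicIdeal (cbIdeal A α).Quotient, x ≠ 0) :
    cbIdeal A (α + 1) ≠ cbIdeal A α := by
  intro heq
  obtain ⟨x, hx, hx0⟩ := h
  obtain ⟨a, rfl⟩ := (cbIdeal A α).mkHom_surjective x
  rw [← mem_cbIdeal_add_one, heq, ← ClosedIdeal.mkHom_eq_zero] at hx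
  exact hx0 hx

/-! ### Essentiality of the atomic layers -/

/-- A nonzero element of `I^At(B)` is not annihilated by all minimal projections. -/
theorem exists_isMinimalProjection_mul_ne_zero {B : Type u} [NonUnitalCStarAlgebra B] {x : B}
    (hx : x ∈ atomicIdeal B) (hx0 : x ≠ 0) : ∃ p, IsMinimalProjection p ∧ p * x ≠ 0 := by
  by_contra! h
  have key : ∀ y ∈ NonUnitalStarAlgebra.adjoin ℂ {q : B | IsMinimalProjection q}, y * x = 0 := by
    -- The left annihilator of `x` is not obviously self-adjoint, so the induction carries `star y`
    -- along.
    have h' : ∀ y ∈ NonUnitalStarAlgebra.adjoin ℂ {q : B | IsMinimalProjection q},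
        y * x = 0 ∧ star y * x = 0 := by
      intro y hy
      induction hy using NonUnitalStarAlgebra.adjoin_induction with
      | mem p hp =>
        rw [(hp.isStarProjection.isSelfAdjoint : star p = p)]
        exact ⟨h p hp, h p hp⟩
      | add y z _ _ h1 h2 =>
        rw [star_add, add_mul, add_mul, h1.1, h1.2, h2.1, h2.2, add_zero]
        exact ⟨rfl, rfl⟩
      | zero => rw [star_zero, zero_mul]; exact ⟨rfl, rfl⟩
      | mul y z _ _ h1 h2 =>
        rw [star_mul, mul_assoc, mul_assoc, h1.2, h2.1, mul_zero, mul_zero]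
        exact ⟨rfl, rfl⟩
      | smul c y _ h1 =>
        rw [star_smul, smul_mul_assoc, smul_mul_assoc, h1.1, h1.2, smul_zero, smul_zero]
        exact ⟨rfl, rfl⟩
      | star y _ h1 => rw [star_star]; exact ⟨h1.2, h1.1⟩
    exact fun y hy => (h' y hy).1
  have hcl : IsClosed {y : B | y * x = 0} := isClosed_eq (by fun_prop) continuous_const
  have hsx : star x * x = 0 :=
    hcl.closure_subset_iff.2 key (show star x ∈ closure _ from (atomicIdeal B).star_mem hx)
  exact hx0 (CStarRing.star_mul_self_eq_zero_iff _ |>.1 hsx)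

/-- If `p * x ≠ 0`, then the minimal projection `p` is a multiple of `p * (x * star x) * p`. -/
theorem IsMinimalProjection.exists_eq_smul {B : Type u} [NonUnitalCStarAlgebra B] {p x : B}
    (hp : IsMinimalProjection p) (hpx : p * x ≠ 0) :
    ∃ c : ℂ, p = c • (p * (x * star x) * p) := by
  obtain ⟨c, hc⟩ := hp.exists_smul (x * star x)
  have hps : star p = p := hp.isStarProjection.isSelfAdjoint
  -- With `c = 0` the product of `p * x` and its adjoint would vanish.
  have hc0 : c ≠ 0 := by
    rintro rfl
    refine hpx (CStarRing.mul_star_self_eq_zero_iff _ |>.1 ?_)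
    rw [star_mul, hps, ← zero_smul ℂ p, ← hc]
    simp only [mul_assoc]
  exact ⟨c⁻¹, by rw [hc, smul_smul, inv_mul_cancel₀ hc0, one_smul]⟩

/-- Let `I ⊆ K` be ideals and let `N` be an ideal with `N ∩ K ⊆ I`. If an element of `N` represents
a minimal projection of `A / K`, then it represents a minimal projection of `A / I`. -/
theorem ClosedIdeal.isMinimalProjection_mkHom {I K N : ClosedIdeal A} (hIK : ∀ x ∈ I, x ∈ K)
    (hN : ∀ x ∈ N, x ∈ K → x ∈ I) {n : A} (hn : n ∈ N)
    (hK : IsMinimalProjection (K.mkHom n)) : IsMinimalProjection (I.mkHom n) := by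
  -- On `N`, congruence modulo `K` implies congruence modulo `I`. The relations defining a minimal
  -- projection are equations between elements of `N`, so they transfer.
  have lift : ∀ x ∈ N, ∀ y ∈ N, K.mkHom x = K.mkHom y → I.mkHom x = I.mkHom y := by
    intro x hx y hy h
    rw [← sub_eq_zero, ← map_sub, mkHom_eq_zero] at h ⊢
    exact hN _ (sub_mem hx hy) h
  refine ⟨⟨?_, ?_⟩, ?_, ?_⟩
  · have h := hK.isStarProjection.isIdempotentElem
    rw [IsIdempotentElem, ← map_mul] at h ⊢
    exact lift _ (N.mul_mem_left _ hn) _ hn h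
  · have h : star (K.mkHom n) = K.mkHom n := hK.isStarProjection.isSelfAdjoint
    change star (I.mkHom n) = I.mkHom n
    rw [← map_star] at h ⊢
    exact lift _ (N.star_mem hn) _ hn h
  · intro h
    exact hK.ne_zero (mkHom_eq_zero.2 (hIK _ (mkHom_eq_zero.1 h)))
  · intro x
    obtain ⟨a, rfl⟩ := I.mkHom_surjective x
    obtain ⟨c, hc⟩ := hK.exists_smul (K.mkHom a)
    refine ⟨c, ?_⟩
    rw [← map_mul, ← map_mul, ← map_smul] at hc ⊢
    exact lift _ (N.mul_mem_left _ hn) _ (N.smul_mem c hn) hc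

/-- An ideal that meets `I_{α+1}` inside `I_α` meets each later `I_β` inside `I_α`. -/
theorem mem_cbIdeal_of_mem_of_inter {α : Ordinal.{u}} {N : ClosedIdeal A}
    (hN : ∀ x ∈ N, x ∈ cbIdeal A (α + 1) → x ∈ cbIdeal A α) :
    ∀ β, α ≤ β → ∀ x ∈ N, x ∈ cbIdeal A β → x ∈ cbIdeal A α := by
  intro β
  induction β using Ordinal.limitRecOn with
  | zero =>
    intro hα x _ hx
    rwa [nonpos_iff_eq_zero.1 hα]
  | add_one β ih =>
    intro hα x hxN hx
    rcases hα.eq_or_lt with rfl | hα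
    · exact hx
    replace hα := Order.lt_add_one_iff.1 hα
    refine ih hα x hxN ?_
    by_contra hxβ
    rw [mem_cbIdeal_add_one] at hx
    rw [← ClosedIdeal.mkHom_eq_zero] at hxβ
    obtain ⟨p, hp, hpx⟩ := exists_isMinimalProjection_mul_ne_zero hx hxβ
    obtain ⟨c, hc⟩ := hp.exists_eq_smul hpx
    obtain ⟨m, rfl⟩ := (cbIdeal A β).mkHom_surjective p
    -- The lift `m` of `p` need not lie in `N`. This other lift does, because it contains the factor
    -- `x ∈ N`.
    set n := c • (m * (x * star x) * m) with hn
    have hnN : n ∈ N := N.smul_mem _ (N.mul_mem_right _ (N.mul_mem_left _ (N.mul_mem_right _ hxN)))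
    have hnm : (cbIdeal A β).mkHom n = (cbIdeal A β).mkHom m := by
      rw [hn, map_smul, map_mul, map_mul, map_mul, map_star]
      exact hc.symm
    have hmin : IsMinimalProjection ((cbIdeal A α).mkHom n) :=
      ClosedIdeal.isMinimalProjection_mkHom (cbIdeal_mono A β α hα) (ih hα) hnN (hnm ▸ hp)
    refine hmin.ne_zero (ClosedIdeal.mkHom_eq_zero.2 (hN n hnN ?_))
    rw [mem_cbIdeal_add_one]
    exact subset_closure (NonUnitalStarAlgebra.subset_adjoin ℂ _ hmin)
  | limit β hβ ih =>
    intro hα x hxN hx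
    rcases hα.eq_or_lt with rfl | hα
    · exact hx
    -- Elements `y` of earlier ideals approximating `x` may lie outside `N`, whereas `star x * y`
    -- lies in `N`. In the limit `star x * x ∈ I_α`, and the C*-identity in the quotient gives `x ∈
    -- I_α`.
    have hcl : IsClosed {y : A | star x * y ∈ cbIdeal A α} :=
      (cbIdeal A α).isClosed.preimage (f := fun y => star x * y) (by fun_prop)
    have hxx : star x * x ∈ cbIdeal A α := by
      have hx' : x ∈ closure (⋃ γ < β, (cbIdeal A γ : Set A)) := coe_cbIdeal_limit A hβ ▸ hx
      refine hcl.closure_subset_iff.2 ?_ hx'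
      intro y hy
      simp only [Set.mem_iUnion] at hy
      obtain ⟨γ, hγ, hy⟩ := hy
      refine ih (max γ α) (max_lt hγ hα) (le_max_right _ _) _
        (N.mul_mem_right _ (N.star_mem hxN)) ?_
      exact (cbIdeal A _).mul_mem_left _ (cbIdeal_mono A _ _ (le_max_left _ _) y hy)
    rw [← ClosedIdeal.mkHom_eq_zero] at hxx ⊢
    rw [map_mul, map_star] at hxx
    exact CStarRing.star_mul_self_eq_zero_iff _ |>.1 hxx

/-! ### Consequences of full noncommutativity -/

theorem subquotient_cbIdeal (α : Ordinal.{u}) :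
    (cbIdeal A α).subquotient (cbIdeal A (α + 1))
      = (atomicIdeal (cbIdeal A α).Quotient).toStarSubalgebra := by
  refine SetLike.ext fun x => ⟨?_, fun hx => ?_⟩
  · rintro ⟨a, ha, rfl⟩
    exact (mem_cbIdeal_add_one A).1 ha
  · obtain ⟨a, rfl⟩ := (cbIdeal A α).mkHom_surjective x
    exact ⟨a, (mem_cbIdeal_add_one A).2 hx, rfl⟩

theorem image_mkHom_cbIdeal (α : Ordinal.{u}) :
    (cbIdeal A α).mkHom '' (cbIdeal A (α + 1))
      = (atomicIdeal (cbIdeal A α).Quotient : Set (cbIdeal A α).Quotient) :=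
  congrArg SetLike.coe (subquotient_cbIdeal (A := A) α)

/-- The ideal `I_{α+1} / I_α` has a faithful representation onto the compact operators. -/
theorem IsFullyNoncommutative.exists_rep (hA : IsFullyNoncommutative A) {α : Ordinal.{u}}
    (hα : cbIdeal A α ≠ ⊤) :
    ∃ (H : Type u) (_ : NormedAddCommGroup H) (_ : InnerProductSpace ℂ H) (_ : CompleteSpace H)
      (φ : (atomicIdeal (cbIdeal A α).Quotient).toStarSubalgebra →⋆ₙₐ[ℂ] (H →L[ℂ] H)),
      Nontrivial H ∧ Function.Injective φ ∧
        ∀ T : H →L[ℂ] H, IsCompactOperator T → ∃ a, φ a = T := by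
  obtain ⟨H, _, _, _, hH, ⟨e⟩⟩ := hA.2 α hα
  rw [subquotient_cbIdeal] at e
  refine ⟨H, inferInstance, inferInstance, inferInstance,
    { toFun := fun a => (e a).1
      map_smul' := fun c a => congrArg Subtype.val (e.map_smul' c a)
      map_zero' := congrArg Subtype.val (map_zero e)
      map_add' := fun a b => congrArg Subtype.val (map_add e a b)
      map_mul' := fun a b => congrArg Subtype.val (map_mul e a b)
      map_star' := fun a => congrArg Subtype.val (map_star e a) }, hH, ?_, ?_⟩
  · exact fun a b h => e.injective (Subtype.ext h)
  · exact fun T hT => ⟨e.symm ⟨T, hT⟩, congrArg Subtype.val (e.apply_symm_apply ⟨T, hT⟩)⟩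

/-- Since `H ≠ 0` there is a nonzero rank-one operator, whose preimage is a nonzero element of the
atomic ideal. -/
theorem IsFullyNoncommutative.cbIdeal_add_one_ne_self (hA : IsFullyNoncommutative A)
    {α : Ordinal.{u}} (hα : cbIdeal A α ≠ ⊤) : cbIdeal A (α + 1) ≠ cbIdeal A α := by
  obtain ⟨H, _, _, _, φ, hH, hφ, hrange⟩ := hA.exists_rep hα
  obtain ⟨v, hv⟩ := exists_ne (0 : H)
  obtain ⟨a, ha⟩ := hrange _ (isCompactOperator_rankOne v v)
  refine _root_.cbIdeal_add_one_ne_self ⟨a, a.2, fun h => ?_⟩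
  have h0 : a = 0 := Subtype.ext h
  rw [h0, map_zero] at ha
  exact InnerProductSpace.rankOne_ne_zero hv hv ha.symm

theorem IsFullyNoncommutative.cbIdeal_ssubset (hA : IsFullyNoncommutative A)
    {α β : Ordinal.{u}} (hα : cbIdeal A α ≠ ⊤) (hαβ : α < β) :
    (cbIdeal A α : Set A) ⊂ cbIdeal A β := by
  refine ⟨cbIdeal_mono A β α hαβ.le, fun h => hA.cbIdeal_add_one_ne_self hα ?_⟩
  refine ClosedIdeal.ext fun x => ⟨fun hx => ?_, fun hx => cbIdeal_mono A _ _ le_self_add x hx⟩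
  exact h (cbIdeal_mono A β (α + 1) (Order.add_one_le_of_lt hαβ) x hx)

/-- If no `I_α` were `A`, the sequence would inject all ordinals of universe `u` into `Set A`, which
lives in `Type u`. -/
theorem IsFullyNoncommutative.cbIdeal_cbHeight (hA : IsFullyNoncommutative A) :
    cbIdeal A (cbHeight A) = ⊤ := by
  refine csInf_mem (s := {α | cbIdeal A α = ⊤}) ?_
  by_contra h
  rw [Set.not_nonempty_iff_eq_empty] at h
  have hne : ∀ α, cbIdeal A α ≠ ⊤ := fun α hα => by
    have : α ∈ {α | cbIdeal A α = ⊤} := hα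
    rwa [h] at this
  refine not_injective_of_ordinal (fun α : Ordinal.{u} => (cbIdeal A α : Set A)) ?_
  exact StrictMono.injective fun α β hαβ => hA.cbIdeal_ssubset (hne α) hαβ

theorem cbIdeal_ne_top_of_lt {α : Ordinal.{u}} (hα : α < cbHeight A) : cbIdeal A α ≠ ⊤ :=
  fun h => notMem_of_lt_csInf' hα h

theorem IsFullyNoncommutative.ccrIdeal_eq (hA : IsFullyNoncommutative A) {α : Ordinal.{u}}
    (hα : cbIdeal A α ≠ ⊤) :
    ccrIdeal (cbIdeal A α).Quotient = atomicIdeal (cbIdeal A α).Quotient := by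
  obtain ⟨H, _, _, _, φ, hH, hφ, hrange⟩ := hA.exists_rep hα
  refine ccrIdeal_eq_atomicIdeal φ hφ hrange fun N hN x hx => ?_
  obtain ⟨a, rfl⟩ := (cbIdeal A α).mkHom_surjective x
  -- The sequence is defined at all ordinals and equals `A` from the height onwards.
  have hle : α ≤ cbHeight A := by
    by_contra! h
    refine hα (ClosedIdeal.ext fun x => ⟨fun _ => ClosedIdeal.mem_top, fun _ => ?_⟩)
    exact cbIdeal_mono A _ _ h.le x (hA.cbIdeal_cbHeight ▸ ClosedIdeal.mem_top)
  refine ClosedIdeal.mkHom_eq_zero.2 (mem_cbIdeal_of_mem_of_inter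
    (N := (cbIdeal A α).pullback N) (fun y hy hy1 => ?_) _ hle a hx
    (hA.cbIdeal_cbHeight ▸ ClosedIdeal.mem_top))
  exact ClosedIdeal.mkHom_eq_zero.1 (hN _ hy ((mem_cbIdeal_add_one A).1 hy1))

/-! ### Comparison with an arbitrary GCR series -/

/-- Keeping `D` general lets one argument serve both the atomic ideal and `CCR`; the two need only
agree on the quotients `A / I_α` with `I_α ≠ A`. -/
theorem IsFullyNoncommutative.isCompositionSeries (hA : IsFullyNoncommutative A)
    (D : ∀ (B : Type u) [NonUnitalCStarAlgebra B], ClosedIdeal B)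
    (hD : ∀ α, cbIdeal A α ≠ ⊤ →
      D (cbIdeal A α).Quotient = atomicIdeal (cbIdeal A α).Quotient) :
    IsCompositionSeries D (cbHeight A) (cbIdeal A) where
  zero := cbIdeal_zero A
  top := hA.cbIdeal_cbHeight
  strictMono _ _ hαβ hβ := hA.cbIdeal_ssubset (cbIdeal_ne_top_of_lt (hαβ.trans_le hβ)) hαβ
  limit _ _ hl := coe_cbIdeal_limit A hl
  succ α hα := by rw [hD α (cbIdeal_ne_top_of_lt hα), image_mkHom_cbIdeal]

theorem ClosedIdeal.eq_of_image_mkHom_eq {I J K : ClosedIdeal A} (hJ : (I : Set A) ⊆ J)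
    (hK : (I : Set A) ⊆ K) (h : I.mkHom '' J = I.mkHom '' K) : J = K := by
  have key : ∀ {J K : ClosedIdeal A}, (I : Set A) ⊆ K → I.mkHom '' J = I.mkHom '' K →
      ∀ x ∈ J, x ∈ K := by
    intro J K hK h x hx
    obtain ⟨y, hy, hxy⟩ := h.subset ⟨x, hx, rfl⟩
    rw [← sub_eq_zero, ← map_sub, mkHom_eq_zero] at hxy
    exact sub_sub_cancel y x ▸ sub_mem hy (hK hxy)
  exact ClosedIdeal.ext fun x => ⟨key hK h x, key hJ h.symm x⟩

theorem IsFullyNoncommutative.eq_cbIdeal (hA : IsFullyNoncommutative A) {γ : Ordinal.{u}}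
    {J : Ordinal.{u} → ClosedIdeal A} (hJ : IsGCRSeries γ J) :
    ∀ α ≤ γ, J α = cbIdeal A α := by
  intro α
  induction α using Ordinal.limitRecOn with
  | zero => exact fun _ => hJ.zero.trans (cbIdeal_zero A).symm
  | add_one α ih =>
    intro hα
    have hαγ : α < γ := Order.add_one_le_iff.1 hα
    have hsub := hJ.strictMono α (α + 1) (Order.lt_add_one_iff.2 le_rfl) hα
    have hsucc := hJ.succ α hαγ
    rw [ih hαγ.le] at hsub hsucc
    -- Strictness of `J` at this step is what makes the equality of `CCR` and the atomic ideal
    -- available.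
    have hne : cbIdeal A α ≠ ⊤ := fun h => hsub.2 fun x _ => by
      rw [h]
      exact ClosedIdeal.mem_top
    refine ClosedIdeal.eq_of_image_mkHom_eq hsub.1 (cbIdeal_mono A _ _ le_self_add) ?_
    rw [hsucc, hA.ccrIdeal_eq hne, image_mkHom_cbIdeal]
  | limit l hl ih =>
    intro hlγ
    refine SetLike.coe_injective ?_
    rw [hJ.limit l hlγ hl, coe_cbIdeal_limit A hl]
    congr 1
    exact Set.iUnion₂_congr fun α hα => by rw [ih α hα (hα.le.trans hlγ)]

end Sequence

theorem mainTheorem9 (A : Type u) [NonUnitalCStarAlgebra A] (hA : IsFullyNoncommutative A) :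
    IsCantorBendixsonSeries (cbHeight A) (cbIdeal A) ∧
      IsGCRSeries (cbHeight A) (cbIdeal A) ∧
      ∀ (γ : Ordinal.{u}) (J : Ordinal.{u} → ClosedIdeal A), IsGCRSeries γ J →
        γ = cbHeight A ∧ ∀ α ≤ γ, J α = cbIdeal A α := by
  refine ⟨hA.isCompositionSeries _ fun _ _ => rfl,
    hA.isCompositionSeries _ fun _ => hA.ccrIdeal_eq, fun γ J hJ => ?_⟩
  have hJI := hA.eq_cbIdeal hJ
  -- `J γ = A` bounds the height by `γ`. Were the height smaller, `J` would already be `A` there,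
  -- against its strict increase up to `γ`.
  refine ⟨le_antisymm ?_ (csInf_le' ((hJI γ le_rfl).symm.trans hJ.top)), hJI⟩
  by_contra! h
  refine (hJ.strictMono _ _ h le_rfl).2 fun x _ => ?_
  rw [hJI _ h.le, hA.cbIdeal_cbHeight]
  exact ClosedIdeal.mem_top
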